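/- Let $A\in\mathbb R^{n\times n}$ be symmetric positive definite and let $\Omega^1,\dots,\Omega^N$ be (possibly overlapping) subsets of $\{1,\dots,n\}$ whose union is $\{1,\dots,n\}$. Put $n^s=\#\Omega^s$ and let $R^s\in\mathbb R^{n^s\times n}$ be the restriction matrix to $\Omega^s$ (the block of columns in $\Omega^s$ is the identity, all other entries are $0$). Let $B^s\in\mathbb R^{n^s\times n^s}$ be symmetric matrices with $A=\sum_{s=1}^N {R^s}^\top B^sR^s$. For each $s$ let $B^s=V^s\Lambda^s{V^s}^\top$ with $V^s$ orthogonal and $\Lambda^s$ diagonal, let $\Lambda^s_+$ be the diagonal block of the positive eigenvalues and $V^s_+$ the block of the corresponding columns of $V^s$, and set $$A^s_+=V^s_+\Lambda^s_+{V^s_+}^\top,\qquad A_+=\sum_{s=1}^N{R^s}^\top A^s_+R^s .$$ Let $D=\big(\sum_{t=1}^N{R^t}^\top R^t\big)^{-1}$, $D^s=R^sD{R^s}^\top$, and let the one-level Neumann--Neumann preconditioner be $$H^{\mathrm{NN}}=\sum_{s=1}^N{R^s}^\top D^s(A^s_+)^\dagger D^sR^s,\qquad (A^s_+)^\dagger=V^s_+(\Lambda^s_+)^{-1}{V^s_+}^\top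 ,$$ where $\dagger$ denotes the Moore--Penrose inverse. Let $0<\tau_\sharp<1$. For each $s$ let $(\lambda^s_k,y^s_k)_{k=1,\dots,n^s}$ be the eigenpairs of the pencil $\big({D^s}^{-1}A^s_+{D^s}^{-1},\,R^sA_+{R^s}^\top\big)$, that is $${D^s}^{-1}A^s_+{D^s}^{-1}y^s_k=\lambda^s_k\,R^sA_+{R^s}^\top y^s_k,\qquad \langle y^s_k,R^sA_+{R^s}^\top y^s_k\rangle=1,\qquad \lambda^s_1\le\dots\le\lambda^s_{n^s},$$ with $(y^s_k)_k$ a basis of $\mathbb R^{n^s}$, and let $Y^s_L$ be the matrix whose columns are the $y^s_k$ with $\lambda^s_k<\tau_\sharp$. Let $V^0_{\mathrm{NN}}(\tau_\sharp)=\sum_{s=1}^N\operatorname{range}({R^s}^\top Y^s_L)$, and let $R^0\in\mathbb R^{n^0\times n}$ be a matrix whose rows form a basis of this space: $V^0_{\mathrm{NN}}(\tau_\sharp)=\operatorname{range}({R^0}^\top)$ and $n^0=\dim V^0_{\mathrm{NN}}(\tau_\sharp)$; assume $n^0<n$. Then $R^0A_+{R^0}^\top$ is invertible, and with $$\Pi=I-{R^0}^\top(R^0A_+{R^0}^\top)^{-1}R^0A_+,\qquad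 H^{\mathrm{NN}}_{\mathrm{hyb}}(\tau_\sharp)=\Pi H^{\mathrm{NN}}\Pi^\top+{R^0}^\top(R^0A_+{R^0}^\top)^{-1}R^0,$$ every eigenvalue $\lambda$ of $H^{\mathrm{NN}}_{\mathrm{hyb}}(\tau_\sharp)A_+$ is real and satisfies $$1\le\lambda\le\frac{\mathcal N(A_+)}{\tau_\sharp}.$$ Here $\mathcal N(A_+)\in\mathbb N$ is a coloring constant with respect to $A_+$, that is, any number such that $\{1,\dots,N\}$ is the union of $\mathcal N(A_+)$ pairwise disjoint subsets $\mathcal C_j$ with the property that $R^sA_+{R^t}^\top=0$ whenever $s\neq t$ belong to the same $\mathcal C_j$. -/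

import Mathlib

open scoped Matrix

namespace GenEO

section Subdomains

variable {n N : ℕ}

/-- The subdomains `Ω 1, …, Ω N` cover the index set; they may overlap. -/
def IsPartition (Ω : Fin N → Finset (Fin n)) : Prop :=
  ∀ i : Fin n, ∃ s : Fin N, i ∈ Ω s

/-- The restriction matrix onto a set of indices `S`. Its rows are indexed by the elements of `S`,
its block of columns in `S` is the identity and all its other entries are zero. -/
def restr (S : Finset (Fin n)) : Matrix S (Fin n) ℝ :=
  Matrix.of fun i j => if (i : Fin n) = j then 1 else 0

/-- The assembled matrix `∑ s, (R s)ᵀ * M s * R s`. -/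
def assemble (Ω : Fin N → Finset (Fin n)) (M : ∀ s, Matrix (Ω s) (Ω s) ℝ) :
    Matrix (Fin n) (Fin n) ℝ :=
  ∑ s, (restr (Ω s))ᵀ * M s * restr (Ω s)

/-- The global scaling matrix `D = (∑ t, (R t)ᵀ * R t)⁻¹`. -/
noncomputable def scaling (Ω : Fin N → Finset (Fin n)) : Matrix (Fin n) (Fin n) ℝ :=
  (∑ t, (restr (Ω t))ᵀ * restr (Ω t))⁻¹

/-- The partition of unity matrix `D s = R s * D * (R s)ᵀ`. -/
noncomputable def unityMatrix (Ω : Fin N → Finset (Fin n)) (s : Fin N) : Matrix (Ω s) (Ω s) ℝ :=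
  restr (Ω s) * scaling Ω * (restr (Ω s))ᵀ

/-- The number `c` is admissible as a coloring constant with respect to `M`: the subdomains can be
distributed into `c` pairwise disjoint classes, in such a way that two different subdomains
of the same class are `M`-orthogonal. -/
def IsColoringConstant (Ω : Fin N → Finset (Fin n)) (M : Matrix (Fin n) (Fin n) ℝ) (c : ℕ) :
    Prop :=
  ∃ C : Fin c → Finset (Fin N),
    (∀ i j, i ≠ j → Disjoint (C i) (C j)) ∧
    (∀ s, ∃ j, s ∈ C j) ∧
    (∀ j, ∀ s ∈ C j, ∀ t ∈ C j, restr (Ω s) * M * (restr (Ω t))ᵀ = 0 ∨ s = t)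

end Subdomains

section Splitting

variable {ι : Type*} [Fintype ι] [DecidableEq ι]

/-- `B = V * diagonal Λ * Vᵀ` with `V` orthogonal. -/
structure IsDiagonalization (B V : Matrix ι ι ℝ) (Λ : ι → ℝ) : Prop where
  orthogonal : V ∈ Matrix.orthogonalGroup ι ℝ
  eq : B = V * Matrix.diagonal Λ * Vᵀ

/-- The columns of `V` that correspond to the positive eigenvalues. -/
def posVecs (V : Matrix ι ι ℝ) (Λ : ι → ℝ) : Matrix ι {k : ι // 0 < Λ k} ℝ :=
  V.submatrix id Subtype.val

/-- The diagonal matrix of the positive eigenvalues. -/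
def posEigs (Λ : ι → ℝ) : Matrix {k : ι // 0 < Λ k} {k : ι // 0 < Λ k} ℝ :=
  Matrix.diagonal fun k => Λ k

open scoped Classical in
/-- The positive part `V₊ * Λ₊ * V₊ᵀ`. -/
noncomputable def localPosPart (V : Matrix ι ι ℝ) (Λ : ι → ℝ) : Matrix ι ι ℝ :=
  posVecs V Λ * posEigs Λ * (posVecs V Λ)ᵀ

open scoped Classical in
/-- The Moore-Penrose inverse `V₊ * Λ₊⁻¹ * V₊ᵀ` of the positive part. -/
noncomputable def localPosPinv (V : Matrix ι ι ℝ) (Λ : ι → ℝ) : Matrix ι ι ℝ :=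
  posVecs V Λ * (posEigs Λ)⁻¹ * (posVecs V Λ)ᵀ

/-- The four Penrose equations (real case). -/
structure IsMoorePenroseInverse (M P : Matrix ι ι ℝ) : Prop where
  mul_mul_left : M * P * M = M
  mul_mul_right : P * M * P = P
  symm_left : (M * P)ᵀ = M * P
  symm_right : (P * M)ᵀ = P * M

theorem isMoorePenroseInverse_localPosPart {B V : Matrix ι ι ℝ} {Λ : ι → ℝ}
    (h : IsDiagonalization B V Λ) :
    IsMoorePenroseInverse (localPosPart V Λ) (localPosPinv V Λ) := by
  classical
  have hV : Vᵀ * V = 1 := by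
    have := (Matrix.mem_orthogonalGroup_iff' ι ℝ).1 h.orthogonal
    simpa [Matrix.star_eq_conjTranspose] using this
  have hU : (posVecs V Λ)ᵀ * posVecs V Λ = 1 := by
    ext i j
    have := congrFun (congrFun hV i) j
    simpa [posVecs, Matrix.mul_apply, Matrix.one_apply, Subtype.ext_iff] using this
  have hdet : IsUnit (posEigs Λ).det := by
    rw [posEigs, Matrix.det_diagonal, isUnit_iff_ne_zero]
    exact Finset.prod_ne_zero_iff.2 fun k _ => k.2.ne'
  have h1 := Matrix.mul_nonsing_inv _ hdet
  have h2 := Matrix.nonsing_inv_mul _ hdet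
  have hMP : localPosPart V Λ * localPosPinv V Λ = posVecs V Λ * (posVecs V Λ)ᵀ := by
    calc _ = posVecs V Λ * (posEigs Λ * ((posVecs V Λ)ᵀ * posVecs V Λ) * (posEigs Λ)⁻¹) *
          (posVecs V Λ)ᵀ := by simp only [localPosPart, localPosPinv, Matrix.mul_assoc]
      _ = _ := by rw [hU, Matrix.mul_one, h1, Matrix.mul_one]
  have hPM : localPosPinv V Λ * localPosPart V Λ = posVecs V Λ * (posVecs V Λ)ᵀ := by
    calc _ = posVecs V Λ * ((posEigs Λ)⁻¹ * ((posVecs V Λ)ᵀ * posVecs V Λ) * posEigs Λ) *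
          (posVecs V Λ)ᵀ := by simp only [localPosPart, localPosPinv, Matrix.mul_assoc]
      _ = _ := by rw [hU, Matrix.mul_one, h2, Matrix.mul_one]
  have key : ∀ X : Matrix {k : ι // 0 < Λ k} ι ℝ,
      posVecs V Λ * (posVecs V Λ)ᵀ * (posVecs V Λ * X) = posVecs V Λ * X := by
    intro X
    rw [Matrix.mul_assoc, ← Matrix.mul_assoc (posVecs V Λ)ᵀ, hU, Matrix.one_mul]
  refine ⟨?_, ?_, ?_, ?_⟩
  · rw [hMP, localPosPart, Matrix.mul_assoc (posVecs V Λ) (posEigs Λ), key]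
  · rw [hPM, localPosPinv, Matrix.mul_assoc (posVecs V Λ) (posEigs Λ)⁻¹, key]
  · rw [hMP, Matrix.transpose_mul, Matrix.transpose_transpose]
  · rw [hPM, Matrix.transpose_mul, Matrix.transpose_transpose]

end Splitting

section Eigenproblem

variable {ι : Type*} [Fintype ι] {m : ℕ}

/-- `(lam k, y k)`, `k = 1, …, m`, is a full system of eigenpairs of the pencil `(MA, MB)`, ordered
by non-decreasing eigenvalue, with `MB`-normalized eigenvectors that form a basis. -/
structure IsEigensystem (MA MB : Matrix ι ι ℝ) (lam : Fin m → ℝ) (y : Fin m → ι → ℝ) : Prop where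
  card_eq : m = Fintype.card ι
  mono : Monotone lam
  eigen : ∀ k, MA *ᵥ y k = lam k • (MB *ᵥ y k)
  normalized : ∀ k, y k ⬝ᵥ (MB *ᵥ y k) = 1
  linearIndependent : LinearIndependent ℝ y

/-- The number `m_L` of low-frequency eigenvalues: the least (zero-based) position of an eigenvalue
that is at least `τ`, and `m` if there is none. -/
noncomputable def lowCount (τ : ℝ) (lam : Fin m → ℝ) : ℕ :=
  sInf ({k : ℕ | ∃ h : k < m, τ ≤ lam ⟨k, h⟩} ∪ {m})

/-- The matrix `Y_L` whose columns are the first `m_L` eigenvectors. -/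
def lowVecs (τ : ℝ) (lam : Fin m → ℝ) (y : Fin m → ι → ℝ) :
    Matrix ι {k : Fin m // (k : ℕ) < lowCount τ lam} ℝ :=
  Matrix.of fun i k => y k i

end Eigenproblem

section TwoLevel

variable {n N : ℕ}

/-- The matrix `A₊`, assembled from the positive parts of the local matrices. -/
noncomputable def APlus (Ω : Fin N → Finset (Fin n)) (V : ∀ s, Matrix (Ω s) (Ω s) ℝ)
    (Λ : ∀ s, Ω s → ℝ) : Matrix (Fin n) (Fin n) ℝ :=
  assemble Ω fun s => localPosPart (V s) (Λ s)

/-- The left matrix `(D s)⁻¹ * A₊ s * (D s)⁻¹` of the local pencil. -/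
noncomputable def pencilLeft (Ω : Fin N → Finset (Fin n)) (V : ∀ s, Matrix (Ω s) (Ω s) ℝ)
    (Λ : ∀ s, Ω s → ℝ) (s : Fin N) : Matrix (Ω s) (Ω s) ℝ :=
  (unityMatrix Ω s)⁻¹ * localPosPart (V s) (Λ s) * (unityMatrix Ω s)⁻¹

/-- The right matrix `R s * A₊ * (R s)ᵀ` of the local pencil. -/
noncomputable def pencilRight (Ω : Fin N → Finset (Fin n)) (V : ∀ s, Matrix (Ω s) (Ω s) ℝ)
    (Λ : ∀ s, Ω s → ℝ) (s : Fin N) : Matrix (Ω s) (Ω s) ℝ :=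
  restr (Ω s) * APlus Ω V Λ * (restr (Ω s))ᵀ

/-- The one-level Neumann-Neumann preconditioner
`∑ s, (R s)ᵀ * D s * (A₊ s)† * D s * R s`. -/
noncomputable def HNN (Ω : Fin N → Finset (Fin n)) (V : ∀ s, Matrix (Ω s) (Ω s) ℝ)
    (Λ : ∀ s, Ω s → ℝ) : Matrix (Fin n) (Fin n) ℝ :=
  assemble Ω fun s => unityMatrix Ω s * localPosPinv (V s) (Λ s) * unityMatrix Ω s

/-- The coarse space `∑ s, range ((R s)ᵀ * Y_L s)`. -/
noncomputable def coarseSpace (Ω : Fin N → Finset (Fin n)) (τ : ℝ)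
    (lam : ∀ s, Fin (Ω s).card → ℝ) (y : ∀ s, Fin (Ω s).card → Ω s → ℝ) :
    Submodule ℝ (Fin n → ℝ) :=
  ⨆ s, LinearMap.range ((restr (Ω s))ᵀ * lowVecs τ (lam s) (y s)).mulVecLin

/-- The rows of `R0` form a basis of the coarse space `V0`, which is not the whole space. -/
structure IsCoarseInterpolation {n0 : ℕ} (V0 : Submodule ℝ (Fin n → ℝ))
    (R0 : Matrix (Fin n0) (Fin n) ℝ) : Prop where
  range_eq : V0 = LinearMap.range R0ᵀ.mulVecLin
  card_eq : n0 = Module.finrank ℝ V0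
  lt : n0 < n

/-- The coarse solve `R0ᵀ * (R0 * M * R0ᵀ)⁻¹ * R0`, exact with respect to `M`. -/
noncomputable def coarseSolve {n0 : ℕ} (M : Matrix (Fin n) (Fin n) ℝ)
    (R0 : Matrix (Fin n0) (Fin n) ℝ) : Matrix (Fin n) (Fin n) ℝ :=
  R0ᵀ * (R0 * M * R0ᵀ)⁻¹ * R0

/-- The coarse projector `Π = I - R0ᵀ * (R0 * M * R0ᵀ)⁻¹ * R0 * M`. -/
noncomputable def coarseProj {n0 : ℕ} (M : Matrix (Fin n) (Fin n) ℝ)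
    (R0 : Matrix (Fin n0) (Fin n) ℝ) : Matrix (Fin n) (Fin n) ℝ :=
  1 - coarseSolve M R0 * M

/-- The hybrid two-level preconditioner `Π * H * Πᵀ + R0ᵀ * (R0 * M * R0ᵀ)⁻¹ * R0`. -/
noncomputable def hybrid {n0 : ℕ} (M H : Matrix (Fin n) (Fin n) ℝ)
    (R0 : Matrix (Fin n0) (Fin n) ℝ) : Matrix (Fin n) (Fin n) ℝ :=
  coarseProj M R0 * H * (coarseProj M R0)ᵀ + coarseSolve M R0

end TwoLevel

end GenEO

namespace GenEO

/-! ### Symmetric forms: colouring estimate and generalized eigenvectors. -/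

section BilinearForms

variable {E : Type*} [AddCommGroup E] [Module ℝ E]

/-! Write `P` for A₊ and `H` for the one-level preconditioner. `P` is positive definite because A ≤
A₊ as quadratic forms (`APlus_pos`), and Π is the `P`-orthogonal projector onto the complement W of
the coarse space. On the coarse space the hybrid operator is the identity, so by
`hybrid_eigenvalue_bounds` it suffices to compare q = ⟨Pw, HPw⟩ with ⟨w, Pw⟩ for w in W.

Let r_s = D_s R_s P w, so that q = Σ ⟨r_s, A_s† r_s⟩ with A_s the local positive part. If A_s z = 0,
then D_s z lies in the kernel of the left pencil form; its prolongation is in the coarse space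
because 0 < τ, so r_s ⟂ z. Hence A_s A_s† r_s = r_s.

Lower bound (`le_dotProduct_HNN_mulVec`): the partition of unity gives ⟨w, Pw⟩ = Σ ⟨R_s w, r_s⟩.
Since also ⟨w, Pw⟩ = Σ ⟨R_s w, A_s R_s w⟩, the sum of the A_s-energies of R_s w - A_s† r_s is q -
⟨w, Pw⟩ ≥ 0. No overlap constant enters.

Upper bound (`dotProduct_HNN_mulVec_le`): split D_s A_s† r_s into low and high modes
(`exists_low_high_splitting`). The low modes are invisible to w, so q = ⟨w, Ph⟩ with h the sum of
the prolonged high modes. Colouring and the eigenvalue threshold give ⟨h, Ph⟩ ≤ (c/τ) q, and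
Cauchy-Schwarz concludes. -/

theorem bilin_sum_self_le_card_mul {ι : Type*} [Fintype ι] (b : LinearMap.BilinForm ℝ E)
    (hsymm : ∀ x y, b x y = b y x) (hnn : ∀ x, 0 ≤ b x x) (z : ι → E) :
    b (∑ i, z i) (∑ i, z i) ≤ Fintype.card ι * ∑ i, b (z i) (z i) := by
  have key : ∀ i j, b (z i) (z j) ≤ (b (z i) (z i) + b (z j) (z j)) / 2 := by
    intro i j
    have h := hnn (z i - z j)
    simp only [map_sub, LinearMap.sub_apply, hsymm (z j) (z i)] at h
    linarith
  calc b (∑ i, z i) (∑ i, z i) = ∑ i, ∑ j, b (z i) (z j) := by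
        simp only [map_sum, LinearMap.sum_apply]
        exact Finset.sum_comm
    _ ≤ ∑ i, ∑ j, (b (z i) (z i) + b (z j) (z j)) / 2 :=
        Finset.sum_le_sum fun i _ => Finset.sum_le_sum fun j _ => key i j
    _ = Fintype.card ι * ∑ i, b (z i) (z i) := by
        simp only [← Finset.sum_div, Finset.sum_add_distrib, Finset.sum_const, Finset.card_univ,
          nsmul_eq_mul, ← Finset.mul_sum]
        ring

/-- If the vectors `v s` of equal colour are mutually `b`-orthogonal, then `c` colours cost at most
a factor `c` in the triangle inequality for the squared energies. -/
theorem bilin_sum_self_le_of_coloring {N c : ℕ} (b : LinearMap.BilinForm ℝ E)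
    (hsymm : ∀ x y, b x y = b y x) (hnn : ∀ x, 0 ≤ b x x) (v : Fin N → E) (col : Fin N → Fin c)
    (horth : ∀ s t, col s = col t → s ≠ t → b (v s) (v t) = 0) :
    b (∑ s, v s) (∑ s, v s) ≤ c * ∑ s, b (v s) (v s) := by
  have hfib : ∑ s, v s = ∑ j, ∑ s with col s = j, v s :=
    (Finset.sum_fiberwise Finset.univ col v).symm
  have hfib' : ∑ s, b (v s) (v s) = ∑ j, ∑ s with col s = j, b (v s) (v s) :=
    (Finset.sum_fiberwise Finset.univ col fun s => b (v s) (v s)).symm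
  have hcls : ∀ j, b (∑ s with col s = j, v s) (∑ s with col s = j, v s) =
      ∑ s with col s = j, b (v s) (v s) := by
    intro j
    simp only [map_sum, LinearMap.sum_apply]
    refine Finset.sum_congr rfl fun s hs => ?_
    refine Finset.sum_eq_single_of_mem s hs fun t ht hts => horth t s ?_ hts
    rw [(Finset.mem_filter.1 hs).2, (Finset.mem_filter.1 ht).2]
  rw [hfib, hfib', ← Finset.sum_congr rfl fun j _ => hcls j]
  simpa using bilin_sum_self_le_card_mul b hsymm hnn fun j => ∑ s with col s = j, v s

variable {m : ℕ} {f g : LinearMap.BilinForm ℝ E} {lam : Fin m → ℝ} {y : Fin m → E}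

theorem eigenvectors_orthogonal (hf : ∀ x z, f x z = f z x) (hg : ∀ x z, g x z = g z x)
    (heig : ∀ k x, f x (y k) = lam k * g x (y k)) {j k : Fin m} (h : lam j ≠ lam k) :
    g (y j) (y k) = 0 := by
  have h1 := heig k (y j)
  have h2 := heig j (y k)
  rw [hf, h1, hg (y k)] at h2
  have : (lam k - lam j) * g (y j) (y k) = 0 := by linarith
  exact (mul_eq_zero.1 this).resolve_left (sub_ne_zero.2 h.symm)

/-- On the span of the eigenvectors with `τ ≤ lam k`, the form `f` dominates `τ • g`. The
eigenvectors of one eigenvalue need not be orthogonal. -/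
theorem mul_le_of_high_eigenvectors (hf : ∀ x z, f x z = f z x) (hg : ∀ x z, g x z = g z x)
    (hgnn : ∀ x, 0 ≤ g x x) (heig : ∀ k x, f x (y k) = lam k * g x (y k)) (τ : ℝ) (α : Fin m → ℝ) :
    τ * g (∑ k with τ ≤ lam k, α k • y k) (∑ k with τ ≤ lam k, α k • y k) ≤
      f (∑ k with τ ≤ lam k, α k • y k) (∑ k with τ ≤ lam k, α k • y k) := by
  -- The weights √(λ_k - τ) turn f - τg on this span into a g-energy. Distinct eigenvalues
  -- contribute no cross terms; equal ones carry equal weights, whose product is λ_k - τ.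
  have h := hgnn (∑ k with τ ≤ lam k, (α k * √(lam k - τ)) • y k)
  rw [← sub_nonneg]
  refine h.trans_eq ?_
  simp only [map_sum, LinearMap.sum_apply, map_smul, LinearMap.smul_apply, smul_eq_mul,
    Finset.mul_sum, ← Finset.sum_sub_distrib]
  refine Finset.sum_congr rfl fun j hj => Finset.sum_congr rfl fun k hk => ?_
  rw [Finset.mem_filter] at hj hk
  rw [heig j (y k)]
  by_cases hjk : lam k = lam j
  · rw [hjk]
    linear_combination (α k * α j * g (y k) (y j)) * Real.mul_self_sqrt (sub_nonneg.2 hj.2)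
  · rw [eigenvectors_orthogonal hf hg heig hjk]
    ring

/-- Splitting of a vector into a low-frequency and a high-frequency part. -/
theorem exists_low_high_splitting (hf : ∀ x z, f x z = f z x) (hg : ∀ x z, g x z = g z x)
    (hfnn : ∀ x, 0 ≤ f x x) (hgnn : ∀ x, 0 ≤ g x x)
    (heig : ∀ k x, f x (y k) = lam k * g x (y k)) (hspan : ⊤ ≤ Submodule.span ℝ (Set.range y))
    (τ : ℝ) (a : E) :
    ∃ aL ∈ Submodule.span ℝ (y '' {k | lam k < τ}), ∃ aH, a = aL + aH ∧ τ * g aH aH ≤ f a a := by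
  obtain ⟨α, rfl⟩ := (Submodule.mem_span_range_iff_exists_fun ℝ).1
    (hspan (Submodule.mem_top (x := a)))
  refine ⟨∑ k with ¬ τ ≤ lam k, α k • y k, ?_, ∑ k with τ ≤ lam k, α k • y k, ?_, ?_⟩
  · refine Submodule.sum_mem _ fun k hk => Submodule.smul_mem _ _ (Submodule.subset_span ⟨k, ?_, rfl⟩)
    simpa using hk
  · rw [add_comm, Finset.sum_filter_add_sum_filter_not]
  -- Low and high eigenvalues lie on opposite sides of τ, so the two parts are f-orthogonal, and
  -- dropping the low part can only decrease the f-energy.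
  · have horth : f (∑ k with ¬ τ ≤ lam k, α k • y k) (∑ k with τ ≤ lam k, α k • y k) = 0 := by
      simp only [map_sum, LinearMap.sum_apply, map_smul, LinearMap.smul_apply, smul_eq_mul,
        Finset.mul_sum]
      refine Finset.sum_eq_zero fun j hj => Finset.sum_eq_zero fun k hk => ?_
      rw [Finset.mem_filter] at hj hk
      rw [heig, eigenvectors_orthogonal hf hg heig]
      · ring
      · intro h
        simp_all
    rw [← Finset.sum_filter_add_sum_filter_not Finset.univ (fun k => τ ≤ lam k)]
    refine (mul_le_of_high_eigenvectors hf hg hgnn heig τ α).trans ?_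
    simp only [map_add, LinearMap.add_apply, horth, hf (∑ k with τ ≤ lam k, α k • y k)
      (∑ k with ¬ τ ≤ lam k, α k • y k)]
    linarith [hfnn (∑ k with ¬ τ ≤ lam k, α k • y k)]

/-- The kernel of `f` is spanned by eigenvectors of the eigenvalue `0`. -/
theorem mem_span_low_of_forall_eq_zero (hgpos : ∀ x, x ≠ 0 → 0 < g x x)
    (heig : ∀ k x, f x (y k) = lam k * g x (y k)) (hli : LinearIndependent ℝ y)
    (hspan : ⊤ ≤ Submodule.span ℝ (Set.range y)) {τ : ℝ} (hτ : 0 < τ) {a : E}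
    (ha : ∀ x, f x a = 0) : a ∈ Submodule.span ℝ (y '' {k | lam k < τ}) := by
  obtain ⟨α, rfl⟩ := (Submodule.mem_span_range_iff_exists_fun ℝ).1
    (hspan (Submodule.mem_top (x := a)))
  have hzero : ∑ k, (α k * lam k) • y k = 0 := by
    have hfg : ∀ x, g x (∑ k, (α k * lam k) • y k) = f x (∑ k, α k • y k) := by
      intro x
      simp only [map_sum, map_smul, smul_eq_mul, heig, mul_assoc]
    by_contra hne
    exact (hgpos _ hne).ne' ((hfg _).trans (ha _))
  have hα := Fintype.linearIndependent_iff.1 hli _ hzero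
  refine Submodule.sum_mem _ fun k _ => ?_
  rcases mul_eq_zero.1 (hα k) with h | h
  · simp [h]
  · exact Submodule.smul_mem _ _ (Submodule.subset_span ⟨k, by simpa [h] using hτ, rfl⟩)

end BilinearForms

theorem dotProduct_mulVec_swap {ι : Type*} [Fintype ι] {M : Matrix ι ι ℝ} (hM : Mᵀ = M)
    (a b : ι → ℝ) : a ⬝ᵥ (M *ᵥ b) = b ⬝ᵥ (M *ᵥ a) := by
  rw [← Matrix.dotProduct_transpose_mulVec, hM]

/-! ### Rayleigh bounds for energy-self-adjoint operators. -/

section Eigenvalues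

/-- Eigenvalues of an operator that is self-adjoint in the energy inner product are real and lie
between the bounds of the Rayleigh quotient. -/
theorem eigenvalue_bounds {ι : Type*} [Fintype ι] [DecidableEq ι] (T P : Matrix ι ι ℝ) (α β : ℝ)
    (hPsymm : Pᵀ = P) (hPpos : ∀ x : ι → ℝ, x ≠ 0 → 0 < x ⬝ᵥ (P *ᵥ x))
    (hT : (P * T)ᵀ = P * T)
    (hα : ∀ x : ι → ℝ, α * (x ⬝ᵥ (P *ᵥ x)) ≤ x ⬝ᵥ (P *ᵥ (T *ᵥ x)))
    (hβ : ∀ x : ι → ℝ, x ⬝ᵥ (P *ᵥ (T *ᵥ x)) ≤ β * (x ⬝ᵥ (P *ᵥ x))) (μ : ℂ)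
    (hμ : Module.End.HasEigenvalue (Matrix.toLin' (T.map Complex.ofReal)) μ) :
    ∃ l : ℝ, μ = (l : ℂ) ∧ α ≤ l ∧ l ≤ β := by
  obtain ⟨x, hx⟩ := hμ.exists_hasEigenvector
  have hx0 := hx.2
  have hTx := hx.apply_eq_smul
  rw [Matrix.toLin'_apply] at hTx
  set u : ι → ℝ := fun i => (x i).re with hu
  set v : ι → ℝ := fun i => (x i).im with hv
  have hTu : T *ᵥ u = μ.re • u - μ.im • v := by
    ext i
    have := congrArg Complex.re (congrFun hTx i)
    simpa [Matrix.mulVec, dotProduct, hu, hv] using this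
  have hTv : T *ᵥ v = μ.im • u + μ.re • v := by
    ext i
    have := congrArg Complex.im (congrFun hTx i)
    simpa [Matrix.mulVec, dotProduct, hu, hv, add_comm] using this
  have huv : u ≠ 0 ∨ v ≠ 0 := by
    by_contra! h
    refine hx0 (funext fun i => Complex.ext ?_ ?_)
    · exact congrFun h.1 i
    · exact congrFun h.2 i
  have hnn : ∀ a : ι → ℝ, 0 ≤ a ⬝ᵥ (P *ᵥ a) := by
    intro a
    by_cases h : a = 0
    · simp [h]
    · exact (hPpos a h).le
  have hpos : 0 < u ⬝ᵥ (P *ᵥ u) + v ⬝ᵥ (P *ᵥ v) := by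
    rcases huv with h | h
    · linarith [hPpos u h, hnn v]
    · linarith [hPpos v h, hnn u]
  -- Symmetry of `P * T` equates ⟨u, PTv⟩ and ⟨v, PTu⟩; the real part of μ cancels and Im μ times
  -- the total energy remains.
  have him : μ.im = 0 := by
    have h := dotProduct_mulVec_swap hT u v
    rw [← Matrix.mulVec_mulVec, ← Matrix.mulVec_mulVec, hTu, hTv] at h
    simp only [Matrix.mulVec_add, Matrix.mulVec_sub, Matrix.mulVec_smul, dotProduct_add,
      dotProduct_sub, dotProduct_smul, smul_eq_mul, dotProduct_mulVec_swap hPsymm v u] at h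
    have : μ.im * (u ⬝ᵥ (P *ᵥ u) + v ⬝ᵥ (P *ᵥ v)) = 0 := by linarith
    exact (mul_eq_zero.1 this).resolve_right hpos.ne'
  refine ⟨μ.re, Complex.ext rfl (by simp [him]), ?_⟩
  have hreal : ∀ a : ι → ℝ, a ≠ 0 → T *ᵥ a = μ.re • a → α ≤ μ.re ∧ μ.re ≤ β := by
    intro a ha h
    have h1 := hα a
    have h2 := hβ a
    rw [h, Matrix.mulVec_smul, dotProduct_smul, smul_eq_mul] at h1 h2
    exact ⟨le_of_mul_le_mul_right h1 (hPpos a ha), le_of_mul_le_mul_right h2 (hPpos a ha)⟩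
  rcases huv with h | h
  · exact hreal u h (by simp [hTu, him])
  · exact hreal v h (by simp [hTv, him])

end Eigenvalues

end GenEO

namespace GenEO

theorem dotProduct_mul_diagonal_mul_transpose_mulVec {ι κ : Type*} [Fintype ι]
    [Fintype κ] [DecidableEq κ]
    (U : Matrix ι κ ℝ) (d : κ → ℝ) (x : ι → ℝ) :
    x ⬝ᵥ ((U * Matrix.diagonal d * Uᵀ) *ᵥ x) = ∑ k, d k * (Uᵀ *ᵥ x) k ^ 2 := by
  rw [← Matrix.mulVec_mulVec, ← Matrix.mulVec_mulVec, Matrix.dotProduct_mulVec,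
    ← Matrix.mulVec_transpose]
  refine Finset.sum_congr rfl fun k _ => ?_
  rw [Matrix.mulVec_diagonal]
  ring

/-! ### Restriction matrices and the partition of unity. -/

section Restriction

variable {n N : ℕ}

theorem restr_mulVec (S : Finset (Fin n)) (x : Fin n → ℝ) :
    restr S *ᵥ x = fun i : S => x i := by
  ext i
  simp [restr, Matrix.mulVec, dotProduct]

theorem restr_mul_diagonal_mul_transpose (S : Finset (Fin n)) (d : Fin n → ℝ) :
    restr S * Matrix.diagonal d * (restr S)ᵀ = Matrix.diagonal fun i : S => d i := by
  ext i j
  rw [Matrix.mul_apply]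
  simp only [Matrix.mul_diagonal, restr, Matrix.of_apply, Matrix.transpose_apply, ite_mul, one_mul,
    zero_mul, mul_ite, mul_one, mul_zero, Matrix.diagonal_apply]
  rw [Finset.sum_ite_eq, if_pos (Finset.mem_univ _)]
  by_cases h : i = j
  · simp [h]
  · rw [if_neg h, if_neg fun h' => h (Subtype.ext h')]

theorem restr_mul_transpose (S : Finset (Fin n)) : restr S * (restr S)ᵀ = 1 := by
  simpa using restr_mul_diagonal_mul_transpose S 1

theorem transpose_restr_mul_diagonal_mul (S : Finset (Fin n)) (d : Fin n → ℝ) :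
    (restr S)ᵀ * Matrix.diagonal (fun i : S => d i) * restr S =
      Matrix.diagonal fun i => if i ∈ S then d i else 0 := by
  ext i j
  rw [Matrix.mul_apply]
  simp only [Matrix.mul_diagonal, restr, Matrix.of_apply, Matrix.transpose_apply, ite_mul, one_mul,
    zero_mul, mul_ite, mul_one, mul_zero, Matrix.diagonal_apply]
  rw [Finset.sum_coe_sort S fun k => if k = j then if k = i then d k else 0 else 0]
  by_cases hij : i = j
  · subst hij
    simp +contextual [Finset.sum_ite_eq']
  · simp only [Finset.sum_ite_eq', if_neg hij, if_neg (Ne.symm hij), ite_self]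

theorem transpose_restr_mul_restr (S : Finset (Fin n)) :
    (restr S)ᵀ * restr S = Matrix.diagonal fun i => if i ∈ S then (1 : ℝ) else 0 := by
  simpa using transpose_restr_mul_diagonal_mul S fun _ => 1

theorem dotProduct_assemble_mulVec (Ω : Fin N → Finset (Fin n))
    (M : ∀ s, Matrix (Ω s) (Ω s) ℝ) (x z : Fin n → ℝ) :
    x ⬝ᵥ (assemble Ω M *ᵥ z) =
      ∑ s, (restr (Ω s) *ᵥ x) ⬝ᵥ (M s *ᵥ (restr (Ω s) *ᵥ z)) := by
  rw [assemble, Matrix.sum_mulVec, dotProduct_sum]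
  refine Finset.sum_congr rfl fun s _ => ?_
  rw [← Matrix.mulVec_mulVec, ← Matrix.mulVec_mulVec, Matrix.dotProduct_transpose_mulVec,
    dotProduct_comm]

theorem transpose_assemble (Ω : Fin N → Finset (Fin n)) {M : ∀ s, Matrix (Ω s) (Ω s) ℝ}
    (hM : ∀ s, (M s)ᵀ = M s) : (assemble Ω M)ᵀ = assemble Ω M := by
  simp only [assemble, Matrix.transpose_sum, Matrix.transpose_mul, Matrix.transpose_transpose, hM,
    Matrix.mul_assoc]

/-- The number of subdomains that contain an index. -/
def multiplicity (Ω : Fin N → Finset (Fin n)) (i : Fin n) : ℝ :=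
  ∑ s, if i ∈ Ω s then (1 : ℝ) else 0

theorem multiplicity_pos {Ω : Fin N → Finset (Fin n)} (hΩ : IsPartition Ω) (i : Fin n) :
    0 < multiplicity Ω i := by
  obtain ⟨s, hs⟩ := hΩ i
  refine Finset.sum_pos' (fun t _ => ?_) ⟨s, Finset.mem_univ s, by simp [hs]⟩
  split_ifs <;> norm_num

theorem sum_diagonal {ι κ : Type*} [DecidableEq ι] (t : Finset κ) (d : κ → ι → ℝ) :
    ∑ s ∈ t, Matrix.diagonal (d s) = Matrix.diagonal fun i => ∑ s ∈ t, d s i := by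
  ext i j
  by_cases h : i = j <;> simp [Matrix.sum_apply, h]

theorem scaling_eq_diagonal {Ω : Fin N → Finset (Fin n)} (hΩ : IsPartition Ω) :
    scaling Ω = Matrix.diagonal fun i => (multiplicity Ω i)⁻¹ := by
  simp only [scaling, transpose_restr_mul_restr, sum_diagonal]
  refine Matrix.inv_eq_right_inv ?_
  rw [Matrix.diagonal_mul_diagonal, ← Matrix.diagonal_one]
  congr 1
  ext i
  exact mul_inv_cancel₀ (multiplicity_pos hΩ i).ne'

theorem unityMatrix_eq_diagonal {Ω : Fin N → Finset (Fin n)} (hΩ : IsPartition Ω) (s : Fin N) :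
    unityMatrix Ω s = Matrix.diagonal fun i : Ω s => (multiplicity Ω i)⁻¹ := by
  rw [unityMatrix, scaling_eq_diagonal hΩ, restr_mul_diagonal_mul_transpose]

theorem transpose_unityMatrix {Ω : Fin N → Finset (Fin n)} (hΩ : IsPartition Ω) (s : Fin N) :
    (unityMatrix Ω s)ᵀ = unityMatrix Ω s := by
  rw [unityMatrix_eq_diagonal hΩ, Matrix.diagonal_transpose]

theorem isUnit_det_unityMatrix {Ω : Fin N → Finset (Fin n)} (hΩ : IsPartition Ω) (s : Fin N) :
    IsUnit (unityMatrix Ω s).det := by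
  rw [unityMatrix_eq_diagonal hΩ, Matrix.det_diagonal, isUnit_iff_ne_zero]
  exact Finset.prod_ne_zero_iff.2 fun i _ => inv_ne_zero (multiplicity_pos hΩ i).ne'

/-- Every index receives the reciprocal of its multiplicity from each subdomain containing it. -/
theorem assemble_unityMatrix {Ω : Fin N → Finset (Fin n)} (hΩ : IsPartition Ω) :
    assemble Ω (unityMatrix Ω) = 1 := by
  simp only [assemble, unityMatrix_eq_diagonal hΩ]
  rw [Finset.sum_congr rfl fun s _ =>
    transpose_restr_mul_diagonal_mul (Ω s) fun i => (multiplicity Ω i)⁻¹, sum_diagonal,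
    ← Matrix.diagonal_one]
  congr 1
  ext i
  have h : ∀ s, (if i ∈ Ω s then (multiplicity Ω i)⁻¹ else 0) =
      (if i ∈ Ω s then (1 : ℝ) else 0) * (multiplicity Ω i)⁻¹ := by
    intro s
    split_ifs <;> simp
  simp only [h, ← Finset.sum_mul]
  exact mul_inv_cancel₀ (multiplicity_pos hΩ i).ne'

end Restriction

/-! ### Positive parts of the local matrices. -/

section Splitting

variable {ι : Type*} [Fintype ι] [DecidableEq ι]

theorem transpose_localPosPart (V : Matrix ι ι ℝ) (Λ : ι → ℝ) :
    (localPosPart V Λ)ᵀ = localPosPart V Λ := by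
  classical
  simp [localPosPart, posEigs, Matrix.mul_assoc]

theorem transpose_localPosPinv (V : Matrix ι ι ℝ) (Λ : ι → ℝ) :
    (localPosPinv V Λ)ᵀ = localPosPinv V Λ := by
  classical
  simp [localPosPinv, posEigs, Matrix.mul_assoc, Matrix.transpose_nonsing_inv]

theorem dotProduct_localPosPart_mulVec (V : Matrix ι ι ℝ) (Λ : ι → ℝ) (x : ι → ℝ) :
    x ⬝ᵥ (localPosPart V Λ *ᵥ x) = ∑ k with 0 < Λ k, Λ k * (Vᵀ *ᵥ x) k ^ 2 := by
  classical
  rw [localPosPart, posEigs, dotProduct_mul_diagonal_mul_transpose_mulVec,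
    Finset.sum_subtype (Finset.univ.filter fun k => 0 < Λ k) (p := fun k => 0 < Λ k) (by simp)]
  rfl

theorem localPosPart_nonneg (V : Matrix ι ι ℝ) (Λ : ι → ℝ) (x : ι → ℝ) :
    0 ≤ x ⬝ᵥ (localPosPart V Λ *ᵥ x) := by
  rw [dotProduct_localPosPart_mulVec]
  exact Finset.sum_nonneg fun k hk =>
    mul_nonneg (Finset.mem_filter.1 hk).2.le (sq_nonneg _)

/-- In the eigenbasis, passing to the positive part only removes non-positive terms. -/
theorem le_localPosPart {B V : Matrix ι ι ℝ} {Λ : ι → ℝ} (h : IsDiagonalization B V Λ)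
    (x : ι → ℝ) : x ⬝ᵥ (B *ᵥ x) ≤ x ⬝ᵥ (localPosPart V Λ *ᵥ x) := by
  rw [dotProduct_localPosPart_mulVec, h.eq, dotProduct_mul_diagonal_mul_transpose_mulVec,
    Finset.sum_filter]
  refine Finset.sum_le_sum fun k _ => ?_
  split_ifs with hk
  · exact le_rfl
  · exact mul_nonpos_of_nonpos_of_nonneg (not_lt.1 hk) (sq_nonneg _)

end Splitting

/-! ### Symmetry and definiteness of the assembled operators. -/

section APlus

variable {n N : ℕ}

theorem transpose_APlus (Ω : Fin N → Finset (Fin n)) (V : ∀ s, Matrix (Ω s) (Ω s) ℝ)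
    (Λ : ∀ s, Ω s → ℝ) : (APlus Ω V Λ)ᵀ = APlus Ω V Λ :=
  transpose_assemble Ω fun s => transpose_localPosPart (V s) (Λ s)

theorem APlus_pos {Ω : Fin N → Finset (Fin n)} {B V : ∀ s, Matrix (Ω s) (Ω s) ℝ}
    {Λ : ∀ s, Ω s → ℝ} (hA : (assemble Ω B).PosDef)
    (hV : ∀ s, IsDiagonalization (B s) (V s) (Λ s)) {x : Fin n → ℝ} (hx : x ≠ 0) :
    0 < x ⬝ᵥ (APlus Ω V Λ *ᵥ x) := by
  have h := hA.dotProduct_mulVec_pos hx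
  rw [star_trivial] at h
  refine h.trans_le ?_
  rw [APlus, dotProduct_assemble_mulVec, dotProduct_assemble_mulVec]
  exact Finset.sum_le_sum fun s _ => le_localPosPart (hV s) _

theorem transpose_HNN {Ω : Fin N → Finset (Fin n)} (hΩ : IsPartition Ω)
    (V : ∀ s, Matrix (Ω s) (Ω s) ℝ) (Λ : ∀ s, Ω s → ℝ) : (HNN Ω V Λ)ᵀ = HNN Ω V Λ :=
  transpose_assemble Ω fun s => by
    rw [Matrix.transpose_mul, Matrix.transpose_mul, transpose_unityMatrix hΩ,
      transpose_localPosPinv, Matrix.mul_assoc]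

end APlus

end GenEO

namespace GenEO

/-! ### Coarse space, coarse projector and reduction to its complement. -/

section CoarseSpace

variable {n N n0 : ℕ}

/-- Monotonicity ties the positional cut-off to the spectral threshold. Only this direction matters:
the coarse space has to contain all the low modes. -/
theorem lt_lowCount {m : ℕ} {τ : ℝ} {lam : Fin m → ℝ} (hmono : Monotone lam) {k : Fin m}
    (hk : lam k < τ) : (k : ℕ) < lowCount τ lam := by
  have hmem : lowCount τ lam ∈ {k : ℕ | ∃ h : k < m, τ ≤ lam ⟨k, h⟩} ∪ {m} :=
    Nat.sInf_mem ⟨m, Or.inr rfl⟩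
  rcases hmem with ⟨hl, hτ⟩ | h
  · by_contra! hle
    exact absurd (hτ.trans (hmono (show (⟨_, hl⟩ : Fin m) ≤ k from hle))) (not_le.2 hk)
  -- The default value `m`: every position counts as low.
  · rw [Set.mem_singleton_iff.1 h]
    exact k.2

/-- Prolongations of low-frequency vectors lie in the coarse space. -/
theorem transpose_restr_mulVec_mem_coarseSpace (Ω : Fin N → Finset (Fin n)) {τ : ℝ}
    {lam : ∀ s, Fin (Ω s).card → ℝ} (hmono : ∀ s, Monotone (lam s))
    (y : ∀ s, Fin (Ω s).card → Ω s → ℝ) (s : Fin N) {a : Ω s → ℝ}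
    (ha : a ∈ Submodule.span ℝ (y s '' {k | lam s k < τ})) :
    (restr (Ω s))ᵀ *ᵥ a ∈ coarseSpace Ω τ lam y := by
  refine Submodule.mem_iSup_of_mem s ?_
  have hle : Submodule.span ℝ (y s '' {k | lam s k < τ}) ≤
      (LinearMap.range ((restr (Ω s))ᵀ * lowVecs τ (lam s) (y s)).mulVecLin).comap
        (restr (Ω s))ᵀ.mulVecLin := by
    rw [Submodule.span_le]
    rintro _ ⟨k, hk, rfl⟩
    refine ⟨Pi.single ⟨k, lt_lowCount (hmono s) hk⟩ 1, ?_⟩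
    rw [Matrix.mulVecLin_apply, ← Matrix.mulVec_mulVec, Matrix.mulVec_single_one]
    rfl
  exact hle ha

/-- Rank-nullity: the rank of `R0ᵀ` is already its number of columns. -/
theorem IsCoarseInterpolation.injective {V0 : Submodule ℝ (Fin n → ℝ)}
    {R0 : Matrix (Fin n0) (Fin n) ℝ} (h : IsCoarseInterpolation V0 R0) :
    Function.Injective R0ᵀ.mulVec := by
  have hker : LinearMap.ker R0ᵀ.mulVecLin = ⊥ := by
    have hrank := LinearMap.finrank_range_add_finrank_ker R0ᵀ.mulVecLin
    rw [← h.range_eq, ← h.card_eq, Module.finrank_fin_fun] at hrank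
    exact Submodule.finrank_eq_zero.1 (by omega)
  exact LinearMap.ker_eq_bot.1 hker

theorem isUnit_galerkin {P : Matrix (Fin n) (Fin n) ℝ} {R0 : Matrix (Fin n0) (Fin n) ℝ}
    (hPpos : ∀ x : Fin n → ℝ, x ≠ 0 → 0 < x ⬝ᵥ (P *ᵥ x))
    (hR0 : Function.Injective R0ᵀ.mulVec) : IsUnit (R0 * P * R0ᵀ) := by
  rw [← Matrix.mulVec_injective_iff_isUnit, ← Matrix.coe_mulVecLin, ← LinearMap.ker_eq_bot,
    LinearMap.ker_eq_bot']
  intro z hz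
  by_contra hne
  refine (hPpos (R0ᵀ *ᵥ z) fun h0 => hne (hR0 (h0.trans (Matrix.mulVec_zero _).symm))).ne' ?_
  rw [dotProduct_comm, Matrix.dotProduct_transpose_mulVec, Matrix.mulVec_mulVec,
    Matrix.mulVec_mulVec, ← Matrix.mulVecLin_apply, hz, dotProduct_zero]

variable {P H : Matrix (Fin n) (Fin n) ℝ} {R0 : Matrix (Fin n0) (Fin n) ℝ}

theorem transpose_coarseSolve (hP : Pᵀ = P) : (coarseSolve P R0)ᵀ = coarseSolve P R0 := by
  simp only [coarseSolve, Matrix.transpose_mul, Matrix.transpose_transpose,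
    Matrix.transpose_nonsing_inv, hP, Matrix.mul_assoc]

theorem transpose_hybrid (hP : Pᵀ = P) (hH : Hᵀ = H) : (hybrid P H R0)ᵀ = hybrid P H R0 := by
  simp only [hybrid, Matrix.transpose_add, Matrix.transpose_mul, Matrix.transpose_transpose, hH,
    transpose_coarseSolve hP, Matrix.mul_assoc]

theorem mul_coarseProj (hunit : IsUnit (R0 * P * R0ᵀ)) : R0 * P * coarseProj P R0 = 0 := by
  have h := Matrix.mul_nonsing_inv _ ((Matrix.isUnit_iff_isUnit_det _).1 hunit)
  rw [coarseProj, coarseSolve, Matrix.mul_sub, Matrix.mul_one, sub_eq_zero]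
  calc R0 * P = (R0 * P * R0ᵀ) * (R0 * P * R0ᵀ)⁻¹ * R0 * P := by rw [h, Matrix.one_mul]
    _ = _ := by simp only [Matrix.mul_assoc]

/-- The range of the coarse projector is energy-orthogonal to the coarse space. -/
theorem coarseProj_orthogonal (hP : Pᵀ = P) (hunit : IsUnit (R0 * P * R0ᵀ)) (x : Fin n → ℝ)
    (z : Fin n0 → ℝ) : (coarseProj P R0 *ᵥ x) ⬝ᵥ (P *ᵥ (R0ᵀ *ᵥ z)) = 0 := by
  rw [dotProduct_mulVec_swap hP, dotProduct_comm, Matrix.dotProduct_transpose_mulVec,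
    Matrix.mulVec_mulVec, Matrix.mulVec_mulVec, mul_coarseProj hunit, Matrix.zero_mulVec,
    dotProduct_zero]

/-- Reduction of the spectral bounds for the hybrid preconditioner to the energy-orthogonal
complement of the coarse space. -/
theorem hybrid_eigenvalue_bounds (hP : Pᵀ = P)
    (hPpos : ∀ x : Fin n → ℝ, x ≠ 0 → 0 < x ⬝ᵥ (P *ᵥ x)) (hH : Hᵀ = H)
    (hunit : IsUnit (R0 * P * R0ᵀ)) {β : ℝ} (hβ : 1 ≤ β)
    (hlower : ∀ w : Fin n → ℝ, (∀ z, w ⬝ᵥ (P *ᵥ (R0ᵀ *ᵥ z)) = 0) →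
      w ⬝ᵥ (P *ᵥ w) ≤ (P *ᵥ w) ⬝ᵥ (H *ᵥ (P *ᵥ w)))
    (hupper : ∀ w : Fin n → ℝ, (∀ z, w ⬝ᵥ (P *ᵥ (R0ᵀ *ᵥ z)) = 0) →
      (P *ᵥ w) ⬝ᵥ (H *ᵥ (P *ᵥ w)) ≤ β * (w ⬝ᵥ (P *ᵥ w)))
    (μ : ℂ) (hμ : Module.End.HasEigenvalue
      (Matrix.toLin' ((hybrid P H R0 * P).map Complex.ofReal)) μ) :
    ∃ l : ℝ, μ = (l : ℂ) ∧ 1 ≤ l ∧ l ≤ β := by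
  have hnn : ∀ x : Fin n → ℝ, 0 ≤ x ⬝ᵥ (P *ᵥ x) := by
    intro x
    by_cases h : x = 0
    · simp [h]
    · exact (hPpos x h).le
  -- Here w = Πx and e is the coarse component of x. They are energy-orthogonal, and Πᵀ P = P Π
  -- separates the two terms of the hybrid operator.
  have hdecomp : ∀ x : Fin n → ℝ, ∃ w e : Fin n → ℝ, (∀ z, w ⬝ᵥ (P *ᵥ (R0ᵀ *ᵥ z)) = 0) ∧
      x ⬝ᵥ (P *ᵥ x) = w ⬝ᵥ (P *ᵥ w) + e ⬝ᵥ (P *ᵥ e) ∧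
      x ⬝ᵥ (P *ᵥ ((hybrid P H R0 * P) *ᵥ x)) =
        (P *ᵥ w) ⬝ᵥ (H *ᵥ (P *ᵥ w)) + e ⬝ᵥ (P *ᵥ e) := by
    intro x
    have horth := coarseProj_orthogonal hP hunit x
    refine ⟨coarseProj P R0 *ᵥ x, coarseSolve P R0 *ᵥ (P *ᵥ x), horth, ?_, ?_⟩
    all_goals
      have hwe : (coarseProj P R0 *ᵥ x) ⬝ᵥ (P *ᵥ (coarseSolve P R0 *ᵥ (P *ᵥ x))) = 0 := by
        have := horth (((R0 * P * R0ᵀ)⁻¹ * R0) *ᵥ (P *ᵥ x))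
        rwa [Matrix.mulVec_mulVec _ R0ᵀ, ← Matrix.mul_assoc] at this
      have hx : x = coarseProj P R0 *ᵥ x + coarseSolve P R0 *ᵥ (P *ᵥ x) := by
        rw [coarseProj, Matrix.sub_mulVec, Matrix.one_mulVec, Matrix.mulVec_mulVec]
        abel
      generalize he : coarseSolve P R0 *ᵥ (P *ᵥ x) = e at *
    · generalize coarseProj P R0 *ᵥ x = w at *
      rw [hx]
      simp only [Matrix.mulVec_add, dotProduct_add, add_dotProduct, hwe,
        dotProduct_mulVec_swap hP e w]
      ring
    · have htp : (coarseProj P R0)ᵀ *ᵥ (P *ᵥ x) = P *ᵥ (coarseProj P R0 *ᵥ x) := by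
        rw [coarseProj, Matrix.transpose_sub, Matrix.transpose_one, Matrix.transpose_mul,
          transpose_coarseSolve hP, hP, Matrix.mulVec_mulVec, Matrix.mulVec_mulVec, Matrix.sub_mul, Matrix.mul_sub,
          Matrix.one_mul, Matrix.mul_one, Matrix.mul_assoc]
      rw [dotProduct_mulVec_swap hP, dotProduct_comm, ← Matrix.mulVec_mulVec, hybrid,
        Matrix.add_mulVec, ← Matrix.mulVec_mulVec, ← Matrix.mulVec_mulVec, htp, he,
        dotProduct_add]
      congr 1
      · rw [← htp, ← Matrix.dotProduct_transpose_mulVec (coarseProj P R0), dotProduct_comm]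
      · rw [dotProduct_comm, ← dotProduct_mulVec_swap hP x e]
        nth_rewrite 1 [hx]
        rw [add_dotProduct, hwe, zero_add]
  refine eigenvalue_bounds _ P 1 β hP hPpos ?_ ?_ ?_ μ hμ
  · rw [Matrix.transpose_mul, Matrix.transpose_mul, transpose_hybrid hP hH, hP, Matrix.mul_assoc]
  · intro x
    obtain ⟨w, e, hw, h1, h2⟩ := hdecomp x
    rw [h1, h2]
    linarith [hlower w hw]
  · intro x
    obtain ⟨w, e, hw, h1, h2⟩ := hdecomp x
    rw [h1, h2]
    -- The coarse component contributes with factor exactly 1, which `hβ` absorbs.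
    nlinarith [hupper w hw, hnn e]

end CoarseSpace

/-! ### Bounds for the one-level preconditioner on the complement. -/

section NeumannNeumann

variable {n N : ℕ} {Ω : Fin N → Finset (Fin n)} {V : ∀ s, Matrix (Ω s) (Ω s) ℝ}
  {Λ : ∀ s, Ω s → ℝ}

/-- The scaled local residual `D s * R s * A₊ * w`. -/
noncomputable def localResidual (Ω : Fin N → Finset (Fin n)) (V : ∀ s, Matrix (Ω s) (Ω s) ℝ)
    (Λ : ∀ s, Ω s → ℝ) (w : Fin n → ℝ) (s : Fin N) : Ω s → ℝ :=
  unityMatrix Ω s *ᵥ (restr (Ω s) *ᵥ (APlus Ω V Λ *ᵥ w))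

/-- Transfers energy-orthogonality of w to the coarse space into orthogonality relations for the
local residuals. -/
theorem localResidual_dotProduct (hΩ : IsPartition Ω) (w : Fin n → ℝ) (s : Fin N)
    (z : Ω s → ℝ) :
    localResidual Ω V Λ w s ⬝ᵥ z =
      w ⬝ᵥ (APlus Ω V Λ *ᵥ ((restr (Ω s))ᵀ *ᵥ (unityMatrix Ω s *ᵥ z))) := by
  rw [dotProduct_mulVec_swap (transpose_APlus Ω V Λ), dotProduct_comm (_ᵀ *ᵥ _),
    Matrix.dotProduct_transpose_mulVec, dotProduct_comm (_ *ᵥ z),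
    dotProduct_mulVec_swap (transpose_unityMatrix hΩ s), dotProduct_comm, localResidual]

/-- A residual that annihilates the kernel of the positive part lies in its range. -/
theorem localPosPart_mulVec_localPosPinv_mulVec {ι : Type*} [Fintype ι] [DecidableEq ι]
    {B V : Matrix ι ι ℝ} {Λ : ι → ℝ} (h : IsDiagonalization B V Λ) {g : ι → ℝ}
    (hg : ∀ z, localPosPart V Λ *ᵥ z = 0 → g ⬝ᵥ z = 0) :
    localPosPart V Λ *ᵥ (localPosPinv V Λ *ᵥ g) = g := by
  have hmp := isMoorePenroseInverse_localPosPart h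
  have hsymm : (localPosPinv V Λ * localPosPart V Λ)ᵀ = localPosPart V Λ * localPosPinv V Λ := by
    rw [Matrix.transpose_mul, transpose_localPosPart, transpose_localPosPinv]
  refine dotProduct_eq _ _ fun ζ => ?_
  -- The vector ζ - P†Pζ, for the positive part P, lies in its kernel, so g pairs equally with ζ and
  -- with P†Pζ.
  have hz := hg (ζ - (localPosPinv V Λ * localPosPart V Λ) *ᵥ ζ) (by
    rw [Matrix.mulVec_sub, Matrix.mulVec_mulVec, ← Matrix.mul_assoc, hmp.mul_mul_left, sub_self])
  rw [dotProduct_sub, sub_eq_zero] at hz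
  rw [hz, Matrix.mulVec_mulVec, ← hsymm, dotProduct_comm, Matrix.dotProduct_transpose_mulVec]

theorem dotProduct_HNN_mulVec (hΩ : IsPartition Ω) (w : Fin n → ℝ) :
    (APlus Ω V Λ *ᵥ w) ⬝ᵥ (HNN Ω V Λ *ᵥ (APlus Ω V Λ *ᵥ w)) =
      ∑ s, localResidual Ω V Λ w s ⬝ᵥ
        (localPosPinv (V s) (Λ s) *ᵥ localResidual Ω V Λ w s) := by
  rw [HNN, dotProduct_assemble_mulVec]
  refine Finset.sum_congr rfl fun s _ => ?_
  rw [← Matrix.mulVec_mulVec, ← Matrix.mulVec_mulVec,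
    dotProduct_mulVec_swap (transpose_unityMatrix hΩ s), dotProduct_comm]
  rfl

theorem dotProduct_APlus_mulVec_eq_sum_localResidual (hΩ : IsPartition Ω) (w : Fin n → ℝ) :
    w ⬝ᵥ (APlus Ω V Λ *ᵥ w) =
      ∑ s, (restr (Ω s) *ᵥ w) ⬝ᵥ localResidual Ω V Λ w s := by
  have h := dotProduct_assemble_mulVec Ω (unityMatrix Ω) w (APlus Ω V Λ *ᵥ w)
  rwa [assemble_unityMatrix hΩ, Matrix.one_mulVec] at h

/-- Lower bound for the one-level preconditioner on vectors with compatible residuals. -/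
theorem le_dotProduct_HNN_mulVec (hΩ : IsPartition Ω) {w : Fin n → ℝ}
    (hrange : ∀ s, localPosPart (V s) (Λ s) *ᵥ
      (localPosPinv (V s) (Λ s) *ᵥ localResidual Ω V Λ w s) = localResidual Ω V Λ w s) :
    w ⬝ᵥ (APlus Ω V Λ *ᵥ w) ≤
      (APlus Ω V Λ *ᵥ w) ⬝ᵥ (HNN Ω V Λ *ᵥ (APlus Ω V Λ *ᵥ w)) := by
  have h1 := dotProduct_APlus_mulVec_eq_sum_localResidual (V := V) (Λ := Λ) hΩ w
  have h2 : w ⬝ᵥ (APlus Ω V Λ *ᵥ w) = ∑ s, (restr (Ω s) *ᵥ w) ⬝ᵥ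
      (localPosPart (V s) (Λ s) *ᵥ (restr (Ω s) *ᵥ w)) := dotProduct_assemble_mulVec Ω _ w w
  -- Each summand is the local energy of R_s w - A_s† r_s, expanded with A_s A_s† r_s = r_s.
  have hnn : 0 ≤ ∑ s, ((restr (Ω s) *ᵥ w) ⬝ᵥ
      (localPosPart (V s) (Λ s) *ᵥ (restr (Ω s) *ᵥ w)) -
      2 * ((restr (Ω s) *ᵥ w) ⬝ᵥ localResidual Ω V Λ w s) +
      localResidual Ω V Λ w s ⬝ᵥ (localPosPinv (V s) (Λ s) *ᵥ localResidual Ω V Λ w s)) := by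
    refine Finset.sum_nonneg fun s _ => ?_
    have h := localPosPart_nonneg (V s) (Λ s)
      (restr (Ω s) *ᵥ w - localPosPinv (V s) (Λ s) *ᵥ localResidual Ω V Λ w s)
    have hsw := dotProduct_mulVec_swap (transpose_localPosPart (V s) (Λ s))
      (localPosPinv (V s) (Λ s) *ᵥ localResidual Ω V Λ w s) (restr (Ω s) *ᵥ w)
    simp only [Matrix.mulVec_sub, dotProduct_sub, sub_dotProduct, hsw, hrange s] at h
    rw [dotProduct_comm (localPosPinv (V s) (Λ s) *ᵥ _)] at h
    linarith
  rw [Finset.sum_add_distrib, Finset.sum_sub_distrib, ← Finset.mul_sum, ← h1, ← h2,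
    ← dotProduct_HNN_mulVec hΩ] at hnn
  linarith

/-- Upper bound for the one-level preconditioner, given a splitting of the local corrections into
components that are energy-orthogonal to `w` and components of controlled energy. -/
theorem dotProduct_HNN_mulVec_le (hΩ : IsPartition Ω) {c : ℕ}
    (hc0 : 0 < c) (hc : IsColoringConstant Ω (APlus Ω V Λ) c)
    (hPnn : ∀ x : Fin n → ℝ, 0 ≤ x ⬝ᵥ (APlus Ω V Λ *ᵥ x)) {τ : ℝ} (hτ : 0 < τ) {w : Fin n → ℝ}
    (aL aH : ∀ s, Ω s → ℝ)
    (hsplit : ∀ s, unityMatrix Ω s *ᵥ (localPosPinv (V s) (Λ s) *ᵥ localResidual Ω V Λ w s) =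
      aL s + aH s)
    (hL : ∀ s, w ⬝ᵥ (APlus Ω V Λ *ᵥ ((restr (Ω s))ᵀ *ᵥ aL s)) = 0)
    (hH : ∀ s, τ * (((restr (Ω s))ᵀ *ᵥ aH s) ⬝ᵥ
      (APlus Ω V Λ *ᵥ ((restr (Ω s))ᵀ *ᵥ aH s))) ≤
      localResidual Ω V Λ w s ⬝ᵥ (localPosPinv (V s) (Λ s) *ᵥ localResidual Ω V Λ w s)) :
    (APlus Ω V Λ *ᵥ w) ⬝ᵥ (HNN Ω V Λ *ᵥ (APlus Ω V Λ *ᵥ w)) ≤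
      c / τ * (w ⬝ᵥ (APlus Ω V Λ *ᵥ w)) := by
  obtain ⟨C, -, hcover, horth⟩ := hc
  choose col hcol using hcover
  have hPsymm := dotProduct_mulVec_swap (transpose_APlus Ω V Λ)
  set P := APlus Ω V Λ with hP
  set q := (P *ᵥ w) ⬝ᵥ (HNN Ω V Λ *ᵥ (P *ᵥ w)) with hq
  set h : Fin n → ℝ := ∑ s, (restr (Ω s))ᵀ *ᵥ aH s with hh
  have hqw : q = w ⬝ᵥ (P *ᵥ h) := by
    rw [hq, hP, dotProduct_HNN_mulVec hΩ, hh, Matrix.mulVec_sum, dotProduct_sum]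
    refine Finset.sum_congr rfl fun s _ => ?_
    rw [localResidual_dotProduct hΩ, hsplit, Matrix.mulVec_add, Matrix.mulVec_add,
      dotProduct_add, hL, zero_add]
  have hcol' : h ⬝ᵥ (P *ᵥ h) ≤ c * ∑ s, ((restr (Ω s))ᵀ *ᵥ aH s) ⬝ᵥ
      (P *ᵥ ((restr (Ω s))ᵀ *ᵥ aH s)) := by
    have := bilin_sum_self_le_of_coloring (Matrix.toBilin' P)
      (fun x z => by simpa only [Matrix.toBilin'_apply'] using hPsymm x z)
      (fun x => by simpa only [Matrix.toBilin'_apply'] using hPnn x)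
      (fun s => (restr (Ω s))ᵀ *ᵥ aH s) col ?_
    · simpa only [Matrix.toBilin'_apply'] using this
    · intro s t hst hne
      have hzero := (horth (col s) s (hcol s) t (hst ▸ hcol t)).resolve_right hne
      rw [Matrix.toBilin'_apply', dotProduct_comm, Matrix.dotProduct_transpose_mulVec,
        Matrix.mulVec_mulVec, Matrix.mulVec_mulVec, hzero, Matrix.zero_mulVec, dotProduct_zero]
  have hτq : τ * (h ⬝ᵥ (P *ᵥ h)) ≤ c * q := by
    calc τ * (h ⬝ᵥ (P *ᵥ h)) ≤ c * ∑ s, τ * (((restr (Ω s))ᵀ *ᵥ aH s) ⬝ᵥ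
          (P *ᵥ ((restr (Ω s))ᵀ *ᵥ aH s))) := by
          rw [← Finset.mul_sum]
          nlinarith
      _ ≤ c * q := by
          rw [hq, hP, dotProduct_HNN_mulVec hΩ]
          gcongr with s
          exact hH s
  have hκ : h ⬝ᵥ (P *ᵥ h) ≤ c / τ * q := by
    rw [div_mul_eq_mul_div, le_div_iff₀ hτ]
    linarith
  have hpos : 0 < (c : ℝ) / τ := div_pos (Nat.cast_pos.2 hc0) hτ
  -- Cauchy-Schwarz in the form |κw - h|² ≥ 0 with κ = c/τ: together with |h|² ≤ κq it gives κq ≤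
  -- κ²|w|², without dividing by q.
  have := hPnn ((c / τ) • w - h)
  simp only [Matrix.mulVec_sub, Matrix.mulVec_smul, dotProduct_sub, sub_dotProduct,
    dotProduct_smul, smul_dotProduct, smul_eq_mul, hPsymm h w, ← hqw] at this
  refine le_of_mul_le_mul_left ?_ hpos
  linarith

end NeumannNeumann

end GenEO

namespace GenEO

/-! ### Energies of the local pencil. -/

section LocalEigenproblem

variable {n N : ℕ} {Ω : Fin N → Finset (Fin n)} {V : ∀ s, Matrix (Ω s) (Ω s) ℝ}
  {Λ : ∀ s, Ω s → ℝ}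

theorem transpose_pencilLeft (hΩ : IsPartition Ω) (s : Fin N) :
    (pencilLeft Ω V Λ s)ᵀ = pencilLeft Ω V Λ s := by
  rw [pencilLeft, Matrix.transpose_mul, Matrix.transpose_mul, Matrix.transpose_nonsing_inv,
    transpose_unityMatrix hΩ, transpose_localPosPart, Matrix.mul_assoc]

theorem transpose_pencilRight (s : Fin N) :
    (pencilRight Ω V Λ s)ᵀ = pencilRight Ω V Λ s := by
  rw [pencilRight, Matrix.transpose_mul, Matrix.transpose_mul, Matrix.transpose_transpose,
    transpose_APlus, Matrix.mul_assoc]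

/-- At a = D_s z the inverse scalings cancel, leaving the local positive-part energy of z. -/
theorem dotProduct_pencilLeft_mulVec (hΩ : IsPartition Ω) (s : Fin N) (a : Ω s → ℝ) :
    a ⬝ᵥ (pencilLeft Ω V Λ s *ᵥ a) = ((unityMatrix Ω s)⁻¹ *ᵥ a) ⬝ᵥ
      (localPosPart (V s) (Λ s) *ᵥ ((unityMatrix Ω s)⁻¹ *ᵥ a)) := by
  have h : ((unityMatrix Ω s)⁻¹)ᵀ = (unityMatrix Ω s)⁻¹ := by
    rw [Matrix.transpose_nonsing_inv, transpose_unityMatrix hΩ]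
  rw [pencilLeft, ← Matrix.mulVec_mulVec, ← Matrix.mulVec_mulVec, dotProduct_mulVec_swap h,
    dotProduct_comm]

theorem dotProduct_pencilRight_mulVec (s : Fin N) (a : Ω s → ℝ) :
    a ⬝ᵥ (pencilRight Ω V Λ s *ᵥ a) =
      ((restr (Ω s))ᵀ *ᵥ a) ⬝ᵥ (APlus Ω V Λ *ᵥ ((restr (Ω s))ᵀ *ᵥ a)) := by
  rw [pencilRight, ← Matrix.mulVec_mulVec, ← Matrix.mulVec_mulVec,
    dotProduct_comm (_ᵀ *ᵥ a), Matrix.dotProduct_transpose_mulVec]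

theorem inv_unityMatrix_mulVec_mulVec (hΩ : IsPartition Ω) (s : Fin N) (z : Ω s → ℝ) :
    (unityMatrix Ω s)⁻¹ *ᵥ (unityMatrix Ω s *ᵥ z) = z := by
  rw [Matrix.mulVec_mulVec, Matrix.nonsing_inv_mul _ (isUnit_det_unityMatrix hΩ s),
    Matrix.one_mulVec]

/-- Since R Rᵀ = 1, prolongation is injective; this makes the right form of the pencil definite. -/
theorem transpose_restr_mulVec_ne_zero (S : Finset (Fin n)) {a : S → ℝ} (ha : a ≠ 0) :
    (restr S)ᵀ *ᵥ a ≠ 0 := by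
  intro h
  refine ha ?_
  rw [← Matrix.one_mulVec a, ← restr_mul_transpose S, ← Matrix.mulVec_mulVec, h,
    Matrix.mulVec_zero]

variable {m : ℕ} {ι : Type*} [Fintype ι] {MA MB : Matrix ι ι ℝ} {lam : Fin m → ℝ}
  {y : Fin m → ι → ℝ}

theorem IsEigensystem.top_le_span (h : IsEigensystem MA MB lam y) :
    ⊤ ≤ Submodule.span ℝ (Set.range y) :=
  (h.linearIndependent.span_eq_top_of_card_eq_finrank' (by
    rw [Fintype.card_fin, h.card_eq, Module.finrank_fintype_fun_eq_card])).ge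

theorem IsEigensystem.toBilin'_apply [DecidableEq ι] (h : IsEigensystem MA MB lam y)
    (k : Fin m) (x : ι → ℝ) :
    Matrix.toBilin' MA x (y k) = lam k * Matrix.toBilin' MB x (y k) := by
  rw [Matrix.toBilin'_apply', Matrix.toBilin'_apply', h.eigen, dotProduct_smul, smul_eq_mul]

end LocalEigenproblem

end GenEO

/-! ### The two-level spectral bound. -/

theorem mainTheorem3 {n N : ℕ}
    (A : Matrix (Fin n) (Fin n) ℝ) (hA : A.PosDef)
    (Ω : Fin N → Finset (Fin n)) (hΩ : GenEO.IsPartition Ω)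
    (B : ∀ s, Matrix (Ω s) (Ω s) ℝ) (hBsymm : ∀ s, (B s).IsSymm)
    (hB : A = GenEO.assemble Ω B)
    (V : ∀ s, Matrix (Ω s) (Ω s) ℝ) (Λ : ∀ s, Ω s → ℝ)
    (hV : ∀ s, GenEO.IsDiagonalization (B s) (V s) (Λ s))
    (τ : ℝ) (hτ0 : 0 < τ) (hτ1 : τ < 1)
    (lam : ∀ s, Fin (Ω s).card → ℝ) (y : ∀ s, Fin (Ω s).card → Ω s → ℝ)
    (hy : ∀ s, GenEO.IsEigensystem (GenEO.pencilLeft Ω V Λ s) (GenEO.pencilRight Ω V Λ s)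
      (lam s) (y s))
    {n0 : ℕ} (R0 : Matrix (Fin n0) (Fin n) ℝ)
    (hR0 : GenEO.IsCoarseInterpolation (GenEO.coarseSpace Ω τ lam y) R0)
    (c : ℕ) (hc : GenEO.IsColoringConstant Ω (GenEO.APlus Ω V Λ) c) :
    IsUnit (R0 * GenEO.APlus Ω V Λ * R0ᵀ) ∧
    ∀ μ : ℂ,
      Module.End.HasEigenvalue
        (Matrix.toLin' ((GenEO.hybrid (GenEO.APlus Ω V Λ) (GenEO.HNN Ω V Λ) R0 *
          GenEO.APlus Ω V Λ).map Complex.ofReal)) μ →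
      ∃ l : ℝ, μ = (l : ℂ) ∧ 1 ≤ l ∧ l ≤ (c : ℝ) / τ := by
  subst hB
  have hP := GenEO.transpose_APlus Ω V Λ
  have hPpos : ∀ x : Fin n → ℝ, x ≠ 0 → 0 < x ⬝ᵥ (GenEO.APlus Ω V Λ *ᵥ x) :=
    fun x hx => GenEO.APlus_pos hA hV hx
  have hPnn : ∀ x : Fin n → ℝ, 0 ≤ x ⬝ᵥ (GenEO.APlus Ω V Λ *ᵥ x) := by
    intro x
    by_cases h : x = 0
    · simp [h]
    · exact (hPpos x h).le
  have hunit := GenEO.isUnit_galerkin hPpos hR0.injective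
  refine ⟨hunit, ?_⟩
  -- As n0 < n, there is an index, hence a subdomain containing it, hence a colour.
  have hc0 : 0 < c := by
    obtain ⟨s, -⟩ := hΩ ⟨n0, hR0.lt⟩
    obtain ⟨C, -, hcover, -⟩ := hc
    exact (hcover s).choose.pos
  have hβ : 1 ≤ (c : ℝ) / τ := by
    rw [le_div_iff₀ hτ0, one_mul]
    exact hτ1.le.trans (Nat.one_le_cast.2 hc0)
  have hcoarse : ∀ w : Fin n → ℝ, (∀ z, w ⬝ᵥ (GenEO.APlus Ω V Λ *ᵥ (R0ᵀ *ᵥ z)) = 0) →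
      ∀ s, ∀ a ∈ Submodule.span ℝ (y s '' {k | lam s k < τ}),
        w ⬝ᵥ (GenEO.APlus Ω V Λ *ᵥ ((GenEO.restr (Ω s))ᵀ *ᵥ a)) = 0 := by
    intro w hw s a ha
    have hmem := GenEO.transpose_restr_mulVec_mem_coarseSpace Ω (fun s => (hy s).mono) y s ha
    rw [hR0.range_eq] at hmem
    obtain ⟨z, hz⟩ := hmem
    rw [← hz]
    exact hw z
  have hleft : ∀ s a b, Matrix.toBilin' (GenEO.pencilLeft Ω V Λ s) a b =
      Matrix.toBilin' (GenEO.pencilLeft Ω V Λ s) b a := by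
    intro s a b
    simpa only [Matrix.toBilin'_apply'] using
      GenEO.dotProduct_mulVec_swap (GenEO.transpose_pencilLeft hΩ s) a b
  have hright : ∀ s a b, Matrix.toBilin' (GenEO.pencilRight Ω V Λ s) a b =
      Matrix.toBilin' (GenEO.pencilRight Ω V Λ s) b a := by
    intro s a b
    simpa only [Matrix.toBilin'_apply'] using
      GenEO.dotProduct_mulVec_swap (GenEO.transpose_pencilRight s) a b
  have hrange : ∀ w : Fin n → ℝ, (∀ z, w ⬝ᵥ (GenEO.APlus Ω V Λ *ᵥ (R0ᵀ *ᵥ z)) = 0) →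
      ∀ s, GenEO.localPosPart (V s) (Λ s) *ᵥ (GenEO.localPosPinv (V s) (Λ s) *ᵥ
        GenEO.localResidual Ω V Λ w s) = GenEO.localResidual Ω V Λ w s := by
    intro w hw s
    refine GenEO.localPosPart_mulVec_localPosPinv_mulVec (hV s) fun z hz => ?_
    rw [GenEO.localResidual_dotProduct hΩ]
    -- For z in the kernel of the positive part, D_s z is in the kernel of the left form, hence a
    -- combination of eigenvectors with eigenvalue 0 < τ.
    refine hcoarse w hw s _ (GenEO.mem_span_low_of_forall_eq_zero
      (f := Matrix.toBilin' (GenEO.pencilLeft Ω V Λ s))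
      (g := Matrix.toBilin' (GenEO.pencilRight Ω V Λ s)) (fun x hx => ?_)
      (hy s).toBilin'_apply (hy s).linearIndependent (hy s).top_le_span hτ0 fun x => ?_)
    · rw [Matrix.toBilin'_apply', GenEO.dotProduct_pencilRight_mulVec]
      exact hPpos _ (GenEO.transpose_restr_mulVec_ne_zero (Ω s) hx)
    · rw [Matrix.toBilin'_apply', GenEO.pencilLeft, ← Matrix.mulVec_mulVec,
        ← Matrix.mulVec_mulVec, GenEO.inv_unityMatrix_mulVec_mulVec hΩ, hz, Matrix.mulVec_zero,
        dotProduct_zero]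
  refine GenEO.hybrid_eigenvalue_bounds hP hPpos (GenEO.transpose_HNN hΩ V Λ) hunit hβ
    (fun w hw => GenEO.le_dotProduct_HNN_mulVec hΩ (hrange w hw)) fun w hw => ?_
  have hsplit := fun s => GenEO.exists_low_high_splitting
    (f := Matrix.toBilin' (GenEO.pencilLeft Ω V Λ s))
    (g := Matrix.toBilin' (GenEO.pencilRight Ω V Λ s)) (hleft s) (hright s)
    (fun x => by
      rw [Matrix.toBilin'_apply', GenEO.dotProduct_pencilLeft_mulVec hΩ]
      exact GenEO.localPosPart_nonneg _ _ _)
    (fun x => by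
      rw [Matrix.toBilin'_apply', GenEO.dotProduct_pencilRight_mulVec]
      exact hPnn _)
    (hy s).toBilin'_apply (hy s).top_le_span τ
    (GenEO.unityMatrix Ω s *ᵥ (GenEO.localPosPinv (V s) (Λ s) *ᵥ
      GenEO.localResidual Ω V Λ w s))
  choose aL haL aH hsum hbound using hsplit
  refine GenEO.dotProduct_HNN_mulVec_le hΩ hc0 hc hPnn hτ0 aL aH hsum
    (fun s => hcoarse w hw s _ (haL s)) fun s => ?_
  have h := hbound s
  -- The left energy of D_s A_s† r_s is ⟨A_s† r_s, A_s A_s† r_s⟩ = ⟨r_s, A_s† r_s⟩, the local share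
  -- of q.
  rwa [Matrix.toBilin'_apply', Matrix.toBilin'_apply', GenEO.dotProduct_pencilLeft_mulVec hΩ,
    GenEO.dotProduct_pencilRight_mulVec, GenEO.inv_unityMatrix_mulVec_mulVec hΩ, hrange w hw s,
    dotProduct_comm (_ *ᵥ GenEO.localResidual Ω V Λ w s)] at h
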